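/- Let $G$ be an abelian second countable locally compact (Hausdorff) group with identity $e$ and Haar measure $\mu$. A *Følner sequence* in $G$ is a sequence $(\Lambda_n)$ of compact subsets with $\mu(\Lambda_n)>0$ for all $n$ and $\lim_{n\to\infty}\mu(\Lambda_n\,\Delta\,(\Lambda_n g))/\mu(\Lambda_n)=0$ for all $g\in G$. It satisfies the *Tempelman condition* if there is a real $c>0$ with $\mu(\Lambda_n^{-1}\Lambda_n)\le c\,\mu(\Lambda_n)$ for all $n$. Let $\mathrm{Hom}(G)$ be the set of all group homomorphisms $G\to G$ (continuous or not). A set $M\subset\mathrm{Hom}(G)$ is *translational* if for all $\varphi_1\ne\varphi_2$ in $M$ the homomorphism $g\mapsto\varphi_2(g)^{-1}\varphi_1(g)$ is in $M$. A *C\*-dynamical system* $(A,\omega,\tau,G)$ consists of a unital C\*-algebra $A$, a state $\omega$ on $A$ and $*$-automorphisms $\tau_g$ of $A$ ($g\in G$) such that $\tau_e=\mathrm{id}$, $\tau_g\circ\tau_h=\tau_{gh}$, $\omega\circ\tau_g=\omega$, and $g\mapsto\omega(a\tau_g(b))$ is Borel measurable for all $a,b\in A$. It is *$M$-weakly mixing*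 relative to a Følner sequence $(\Gamma_n)$ if, for all $\varphi\in M$ and $a,b\in A$, the function $g\mapsto\omega(a\tau_{\varphi(g)}(b))$ is Borel measurable and $$\lim_{n\to\infty}\frac1{\mu(\Gamma_n)}\int_{\Gamma_n}\left|\omega(a\tau_{\varphi(g)}(b))-\omega(a)\omega(b)\right|dg=0 .$$ It is *$M$-asymptotically abelian* relative to $(\Lambda_n)$ if, for all $\varphi\in M$ and $a,b\in A$, the map $g\mapsto\tau_{\varphi(g)}(b)$ is continuous in the norm topology of $A$ and $$\lim_{n\to\infty}\frac1{\mu(\Lambda_n)}\int_{\Lambda_n}\left\|a\tau_{\varphi(g)}(b)-\tau_{\varphi(g)}(b)a\right\|dg=0 .$$ **Theorem.** Let $(\Lambda_n)$ be a Følner sequence in $G$ which satisfies the Tempelman condition and such that $(\Lambda_n^{-1}\Lambda_n)$ is also a Følner sequence in $G$. Let $M\subset\mathrm{Hom}(G)$ be translational. Let $(A,\omega,\tau,G)$ be a C\*-dynamical system which is $M$-weakly mixing relative to some Følner sequence $(\Gamma_n)$ in $G$ (for example $\Gamma_n=\Lambda_n$) and $M$-asymptotically abelian relative to $(\Lambda_n)$.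 Then for every $k$, all $a_0,\dots,a_k\in A$ and all pairwise distinct $\varphi_1,\dots,\varphi_k\in M$, with $\varphi_0(g)=e$ for all $g\in G$, $$\lim_{n\to\infty}\frac1{\mu(\Lambda_n)}\int_{\Lambda_n}\left|\omega\left(\prod_{j=0}^k\tau_{\varphi_j(g)}(a_j)\right)-\prod_{j=0}^k\omega(a_j)\right|dg=0,$$ where $\prod_{j=0}^k b_j$ denotes the ordered product $b_0b_1\cdots b_k$. -/

import Mathlib

open MeasureTheory Filter Topology
open scoped Pointwise ComplexOrder

/-- A Følner sequence in an abelian locally compact group `G` with Haar measure `μ`: a sequence of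
compact sets of strictly positive measure such that `μ (g Λₙ ∆ Λₙ) / μ (Λₙ) → 0` for every `g`.
As `G` is abelian, the translate `g • Λₙ` is also `Λₙ g`. -/
structure IsFolnerSequence {G : Type*} [CommGroup G] [TopologicalSpace G] [MeasurableSpace G]
    (μ : Measure G) (Λ : ℕ → Set G) : Prop where
  isCompact : ∀ n, IsCompact (Λ n)
  measure_pos : ∀ n, 0 < μ (Λ n)
  isFoelner : IsFoelner G μ atTop Λ

/-- The Tempelman condition: `μ (Λₙ⁻¹ Λₙ) ≤ c μ (Λₙ)` for all `n`, with a real constant `c > 0`. -/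
def TempelmanCondition {G : Type*} [CommGroup G] [MeasurableSpace G]
    (μ : Measure G) (Λ : ℕ → Set G) : Prop :=
  ∃ c : ℝ, 0 < c ∧ ∀ n, μ ((Λ n)⁻¹ * Λ n) ≤ ENNReal.ofReal c * μ (Λ n)

/-- A set `M` of (not necessarily continuous) endomorphisms of the abelian group `G` is
translational if `g ↦ φ₂(g)⁻¹ φ₁(g)` lies in `M` for all distinct `φ₁, φ₂ ∈ M`. -/
def IsTranslational {G : Type*} [CommGroup G] (M : Set (G →* G)) : Prop :=
  ∀ φ₁ ∈ M, ∀ φ₂ ∈ M, φ₁ ≠ φ₂ → φ₂⁻¹ * φ₁ ∈ M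

/-- A C*-dynamical system `(A, ω, τ, G)`: a state `ω` on the unital C*-algebra `A` and an action
`τ` of `G` on `A` by *-automorphisms which preserves `ω`, such that every function
`g ↦ ω (a τ_g(b))` is Borel measurable. -/
structure CStarDynamicalSystem (G A : Type*) [Group G] [MeasurableSpace G] [CStarAlgebra A] where
  /-- the state -/
  ω : A →ₗ[ℂ] ℂ
  /-- the action; multiplication of *-automorphisms is composition -/
  τ : G →* (A ≃⋆ₐ[ℂ] A)
  map_star_mul_self_nonneg : ∀ a, 0 ≤ ω (star a * a)
  map_one : ω 1 = 1
  measurable : ∀ a b, Measurable fun g => ω (a * τ g b)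
  invariant : ∀ g a, ω (τ g a) = ω a

namespace CStarDynamicalSystem

/-- `M`-weak mixing relative to the sequence `Λ`: the functions `g ↦ ω (a τ_{φ(g)}(b))` are Borel
measurable and the averages of `|ω (a τ_{φ(g)}(b)) - ω(a) ω(b)|` over `Λₙ` tend to `0`, for all
`φ ∈ M` and all `a, b`. -/
structure IsWeaklyMixing {G A : Type*} [Group G] [MeasurableSpace G] [CStarAlgebra A]
    (S : CStarDynamicalSystem G A) (μ : Measure G) (M : Set (G →* G)) (Λ : ℕ → Set G) :
    Prop where
  measurable : ∀ φ ∈ M, ∀ a b, Measurable fun g => S.ω (a * S.τ (φ g) b)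
  tendsto : ∀ φ ∈ M, ∀ a b, Tendsto
    (fun n => (μ.real (Λ n))⁻¹ * ∫ g in Λ n, ‖S.ω (a * S.τ (φ g) b) - S.ω a * S.ω b‖ ∂μ)
    atTop (𝓝 0)

/-- `M`-asymptotic abelianness relative to the sequence `Λ`: the maps `g ↦ τ_{φ(g)}(b)` are norm
continuous and the averages of `‖[a, τ_{φ(g)}(b)]‖` over `Λₙ` tend to `0`, for all `φ ∈ M` and all
`a, b`. -/
structure IsAsymptoticallyAbelian {G A : Type*} [Group G] [TopologicalSpace G] [MeasurableSpace G]
    [CStarAlgebra A] (S : CStarDynamicalSystem G A) (μ : Measure G) (M : Set (G →* G))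
    (Λ : ℕ → Set G) : Prop where
  continuous : ∀ φ ∈ M, ∀ b, Continuous fun g => S.τ (φ g) b
  tendsto : ∀ φ ∈ M, ∀ a b, Tendsto
    (fun n => (μ.real (Λ n))⁻¹ * ∫ g in Λ n, ‖a * S.τ (φ g) b - S.τ (φ g) b * a‖ ∂μ)
    atTop (𝓝 0)

end CStarDynamicalSystem

/-!
The theorem is proved by induction on the number of homomorphisms, by a van der Corput argument in
the GNS space of the state that keeps track of averages of absolute values.

Let `f(g) = τ_{φ₁(g)}(a₁) ⋯ τ_{φₖ(g)}(aₖ) - ω(a₁) ⋯ ω(aₖ)`, regarded as a vector of the GNS space.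
What has to be shown is that `|⟪x, f(g)⟫|` averages to `0` along `Λ` for every vector `x = a₀*`.
By asymptotic abelianness, the products occurring in `f(g)* f(gh)` may be rearranged in mean
(`CStarDynamicalSystem.isNull_star_orbitProd_mul`), so that `⟪f(g), f(gh)⟫` becomes
`ω(∏ⱼ τ_{φⱼ(g)}(bⱼ))` with `bⱼ = aⱼ* τ_{φⱼ(h)}(aⱼ)`, up to terms of the same kind. Invariance of
the state removes `φ₁`, and leaves the `k - 1` homomorphisms `φ₁⁻¹ φⱼ`, which again lie in the
translational set `M`. By the induction hypothesis, `⟪f(g), f(gh)⟫` is therefore close in mean to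
`γ(h) = ∏ⱼ ω(bⱼ) - |∏ⱼ ω(aⱼ)|²`, and weak mixing says that `γ` averages to `0` along `Γ`
(`CStarDynamicalSystem.isNull_stateProd_corrList`).

Since the averages along `Γ` are asymptotically invariant, `γ` takes small values simultaneously at
finitely many translates of some point. Hence there are arbitrarily long finite families of
translates of `f` which are almost orthogonal in mean, and a Bessel-type inequality
(`sq_sum_norm_inner_le`) bounds the mean over such a family of `|⟪x, f(g gᵢ)⟫|`. As the averages along
`Λ` are asymptotically invariant too, this is also a bound for the averages of `|⟪x, f(g)⟫|`
(`isNull_inner_of_correlations`).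

Because the translates are chosen one at a time, instead of being averaged over `Λₙ⁻¹ Λₙ`,
no growth condition on `Λ` enters, and `Γ` need not be related to `Λ`.
-/

/-! ### Bounded continuous functions and asymptotically invariant averages -/

/-- A bounded continuous function. -/
structure IsBddCont {G E : Type*} [TopologicalSpace G] [SeminormedAddCommGroup E] (u : G → E) :
    Prop where
  continuous : Continuous u
  bdd : ∃ C, ∀ g, ‖u g‖ ≤ C

namespace IsBddCont

section Group

variable {G E : Type*} [TopologicalSpace G] [SeminormedAddCommGroup E] {u v : G → E}

theorem const (x : E) : IsBddCont fun _ : G => x := ⟨continuous_const, ‖x‖, fun _ => le_rfl⟩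

theorem norm (hu : IsBddCont u) : IsBddCont fun g => ‖u g‖ :=
  ⟨hu.continuous.norm, by simpa using hu.bdd⟩

theorem add (hu : IsBddCont u) (hv : IsBddCont v) : IsBddCont fun g => u g + v g := by
  obtain ⟨C, hC⟩ := hu.bdd
  obtain ⟨D, hD⟩ := hv.bdd
  exact ⟨hu.continuous.add hv.continuous, C + D,
    fun g => (norm_add_le _ _).trans (add_le_add (hC g) (hD g))⟩

theorem sub (hu : IsBddCont u) (hv : IsBddCont v) : IsBddCont fun g => u g - v g := by
  obtain ⟨C, hC⟩ := hu.bdd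
  obtain ⟨D, hD⟩ := hv.bdd
  exact ⟨hu.continuous.sub hv.continuous, C + D,
    fun g => (norm_sub_le _ _).trans (add_le_add (hC g) (hD g))⟩

theorem sum {ι : Type*} (s : Finset ι) {w : ι → G → E} (hw : ∀ i ∈ s, IsBddCont (w i)) :
    IsBddCont fun g => ∑ i ∈ s, w i g := by
  classical
  induction s using Finset.induction_on with
  | empty => simpa using const (0 : E)
  | insert i s hi ih =>
    simp only [Finset.sum_insert hi]
    exact (hw i (by simp)).add (ih fun j hj => hw j (by simp [hj]))

theorem comp_mul_right [Mul G] [ContinuousMul G] (hu : IsBddCont u) (h : G) :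
    IsBddCont fun g => u (g * h) := by
  obtain ⟨C, hC⟩ := hu.bdd
  exact ⟨hu.continuous.comp (continuous_mul_const h), C, fun g => hC _⟩

end Group

theorem integrable {G : Type*} [TopologicalSpace G] [MeasurableSpace G] [OpensMeasurableSpace G]
    {u : G → ℝ} {ν : Measure G} [IsFiniteMeasure ν] (hu : IsBddCont u) : Integrable u ν := by
  obtain ⟨C, hC⟩ := hu.bdd
  exact .of_bound hu.continuous.aestronglyMeasurable C (.of_forall hC)

section Ring

variable {G A : Type*} [TopologicalSpace G] [SeminormedRing A] {u v : G → A}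

theorem mul (hu : IsBddCont u) (hv : IsBddCont v) : IsBddCont fun g => u g * v g := by
  obtain ⟨C, hC⟩ := hu.bdd
  obtain ⟨D, hD⟩ := hv.bdd
  exact ⟨hu.continuous.mul hv.continuous, C * D, fun g => (norm_mul_le _ _).trans
    (mul_le_mul (hC g) (hD g) (norm_nonneg _) ((norm_nonneg _).trans (hC g)))⟩

end Ring

theorem star {G A : Type*} [TopologicalSpace G] [CStarAlgebra A] {u : G → A} (hu : IsBddCont u) :
    IsBddCont fun g => star (u g) :=
  ⟨hu.continuous.star, by simpa using hu.bdd⟩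

theorem clm_apply {G E F : Type*} [TopologicalSpace G] [SeminormedAddCommGroup E]
    [SeminormedAddCommGroup F] [NormedSpace ℂ E] [NormedSpace ℂ F] {u : G → E} (hu : IsBddCont u)
    (T : E →L[ℂ] F) : IsBddCont fun g => T (u g) := by
  obtain ⟨C, hC⟩ := hu.bdd
  exact ⟨T.continuous.comp hu.continuous, ‖T‖ * C, fun g => T.le_opNorm_of_le (hC g)⟩

end IsBddCont

/-- A sequence of (probability) measures on `G` whose means of bounded continuous functions are
asymptotically invariant under translations; the normalized restrictions of the Haar measure to a
Følner sequence are the example of interest. -/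
def IsAsymptoticallyInvariant {G : Type*} [Group G] [TopologicalSpace G] [MeasurableSpace G]
    (ν : ℕ → Measure G) : Prop :=
  ∀ u : G → ℝ, IsBddCont u → ∀ h,
    Tendsto (fun n => (∫ g, u (g * h) ∂ν n) - ∫ g, u g ∂ν n) atTop (𝓝 0)

/-- A bounded continuous function whose norm has averages tending to `0`. -/
structure IsNull {G E : Type*} [TopologicalSpace G] [MeasurableSpace G] [SeminormedAddCommGroup E]
    (ν : ℕ → Measure G) (u : G → E) : Prop where
  isBddCont : IsBddCont u
  tendsto : Tendsto (fun n => ∫ g, ‖u g‖ ∂ν n) atTop (𝓝 0)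

namespace IsNull

section Basic

variable {G E : Type*} [TopologicalSpace G] [MeasurableSpace G] [SeminormedAddCommGroup E]
  {ν : ℕ → Measure G} {u : G → E}

theorem zero : IsNull ν fun _ => (0 : E) := ⟨.const 0, by simp⟩

theorem norm (hu : IsNull ν u) : IsNull ν fun g => ‖u g‖ :=
  ⟨hu.isBddCont.norm, by simpa using hu.tendsto⟩

theorem comp_mul_right [Group G] [ContinuousMul G] (hν : IsAsymptoticallyInvariant ν)
    (hu : IsNull ν u) (h : G) : IsNull ν fun g => u (g * h) :=
  ⟨hu.isBddCont.comp_mul_right h, by simpa using (hν _ hu.isBddCont.norm h).add hu.tendsto⟩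

end Basic

variable {G : Type*} [TopologicalSpace G] [MeasurableSpace G] [OpensMeasurableSpace G]
  {ν : ℕ → Measure G} [∀ n, IsProbabilityMeasure (ν n)]

section Group

variable {E F : Type*} [SeminormedAddCommGroup E] [SeminormedAddCommGroup F] {u v : G → E}

theorem of_norm_le_mul {w : G → F} (hw : IsBddCont w)
    (hu : IsNull ν u) (C : ℝ) (h : ∀ g, ‖w g‖ ≤ C * ‖u g‖) : IsNull ν w := by
  refine ⟨hw, squeeze_zero (fun n => integral_nonneg fun g => norm_nonneg _) (fun n => ?_)
    (by simpa using hu.tendsto.const_mul C)⟩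
  rw [← integral_const_mul]
  exact integral_mono hw.norm.integrable (hu.isBddCont.norm.integrable.const_mul C) h

theorem add (hu : IsNull ν u) (hv : IsNull ν v) :
    IsNull ν fun g => u g + v g := by
  refine ⟨hu.isBddCont.add hv.isBddCont, squeeze_zero
    (fun n => integral_nonneg fun g => norm_nonneg _) (fun n => ?_)
    (by simpa using hu.tendsto.add hv.tendsto)⟩
  rw [← integral_add hu.isBddCont.norm.integrable hv.isBddCont.norm.integrable]
  exact integral_mono (hu.isBddCont.add hv.isBddCont).norm.integrable
    (hu.isBddCont.norm.integrable.add hv.isBddCont.norm.integrable) fun g => norm_add_le _ _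

theorem sub (hu : IsNull ν u) (hv : IsNull ν v) :
    IsNull ν fun g => u g - v g := by
  refine ⟨hu.isBddCont.sub hv.isBddCont, squeeze_zero
    (fun n => integral_nonneg fun g => norm_nonneg _) (fun n => ?_)
    (by simpa using hu.tendsto.add hv.tendsto)⟩
  rw [← integral_add hu.isBddCont.norm.integrable hv.isBddCont.norm.integrable]
  exact integral_mono (hu.isBddCont.sub hv.isBddCont).norm.integrable
    (hu.isBddCont.norm.integrable.add hv.isBddCont.norm.integrable) fun g => norm_sub_le _ _

theorem sum {ι : Type*} (s : Finset ι) {w : ι → G → E}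
    (hw : ∀ i ∈ s, IsNull ν (w i)) : IsNull ν fun g => ∑ i ∈ s, w i g := by
  classical
  induction s using Finset.induction_on with
  | empty => simpa using zero
  | insert i s hi ih =>
    simp only [Finset.sum_insert hi]
    exact (hw i (by simp)).add (ih fun j hj => hw j (by simp [hj]))

/-- A null function takes arbitrarily small values. -/
theorem exists_norm_lt (hu : IsNull ν u) {ε : ℝ} (hε : 0 < ε) :
    ∃ g, ‖u g‖ < ε := by
  by_contra! H
  obtain ⟨n, hn⟩ := (hu.tendsto.eventually_lt_const hε).exists
  have h := integral_mono (integrable_const (μ := ν n) ε) hu.isBddCont.norm.integrable H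
  simp only [integral_const, probReal_univ, one_smul] at h
  exact absurd hn h.not_gt

theorem clm_apply [NormedSpace ℂ E] [NormedSpace ℂ F] (hu : IsNull ν u)
    (T : E →L[ℂ] F) : IsNull ν fun g => T (u g) :=
  hu.of_norm_le_mul (hu.isBddCont.clm_apply T) ‖T‖ fun _ => T.le_opNorm _

end Group

section Ring

variable {A : Type*} [SeminormedRing A] {u v : G → A}

theorem mul_left (hv : IsBddCont v) (hu : IsNull ν u) :
    IsNull ν fun g => v g * u g := by
  obtain ⟨C, hC⟩ := hv.bdd
  exact hu.of_norm_le_mul (hv.mul hu.isBddCont) C fun g =>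
    (norm_mul_le _ _).trans (by gcongr; exact hC g)

theorem mul_right (hu : IsNull ν u) (hv : IsBddCont v) :
    IsNull ν fun g => u g * v g := by
  obtain ⟨C, hC⟩ := hv.bdd
  refine hu.of_norm_le_mul (hu.isBddCont.mul hv) C fun g => (norm_mul_le _ _).trans ?_
  rw [mul_comm]
  gcongr
  exact hC g

end Ring

theorem star {A : Type*} [CStarAlgebra A] {u : G → A}
    (hu : IsNull ν u) : IsNull ν fun g => star (u g) :=
  hu.of_norm_le_mul hu.isBddCont.star 1 fun g => by simp

end IsNull

/-! ### Følner sequences -/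

theorem IsFolnerSequence.measure_ne_top {G : Type*} [CommGroup G] [TopologicalSpace G]
    [MeasurableSpace G] {μ : Measure G} [IsFiniteMeasureOnCompacts μ] {Λ : ℕ → Set G}
    (hΛ : IsFolnerSequence μ Λ) (n : ℕ) : μ (Λ n) ≠ ⊤ :=
  (hΛ.isCompact n).measure_ne_top

theorem IsFolnerSequence.isProbabilityMeasure_cond {G : Type*} [CommGroup G] [TopologicalSpace G]
    [MeasurableSpace G] {μ : Measure G} [IsFiniteMeasureOnCompacts μ] {Λ : ℕ → Set G}
    (hΛ : IsFolnerSequence μ Λ) (n : ℕ) : IsProbabilityMeasure (ProbabilityTheory.cond μ (Λ n)) :=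
  ProbabilityTheory.cond_isProbabilityMeasure_of_finite (hΛ.measure_pos n).ne' (hΛ.measure_ne_top n)

theorem integral_cond {G : Type*} [MeasurableSpace G] (μ : Measure G) (s : Set G) (u : G → ℝ) :
    ∫ g, u g ∂(ProbabilityTheory.cond μ s) = (μ.real s)⁻¹ * ∫ g in s, u g ∂μ := by
  rw [ProbabilityTheory.cond, integral_smul_measure, ENNReal.toReal_inv, smul_eq_mul]; rfl

theorem norm_setIntegral_sub_le_measureReal_symmDiff {G : Type*} [MeasurableSpace G] {μ : Measure G}
    {s t : Set G} (hs : MeasurableSet s) (ht : MeasurableSet t) (hs' : μ s ≠ ⊤) (ht' : μ t ≠ ⊤)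
    {u : G → ℝ} (hu : AEStronglyMeasurable u μ) {C : ℝ} (hC : ∀ g, ‖u g‖ ≤ C) :
    ‖(∫ g in s, u g ∂μ) - ∫ g in t, u g ∂μ‖ ≤ C * μ.real (symmDiff s t) := by
  have hi : ∀ r, μ r ≠ ⊤ → IntegrableOn u r μ := fun r hr =>
    Measure.integrableOn_of_bounded hr hu (.of_forall hC)
  have hst : MeasurableSet (s \ t) := hs.diff ht
  have hts : MeasurableSet (t \ s) := ht.diff hs
  have fst : μ (s \ t) ≠ ⊤ := measure_ne_top_of_subset Set.sdiff_subset hs'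
  have fts : μ (t \ s) ≠ ⊤ := measure_ne_top_of_subset Set.sdiff_subset ht'
  rw [← integral_inter_add_sdiff ht (hi s hs'), ← integral_inter_add_sdiff hs (hi t ht'),
    Set.inter_comm t s, add_sub_add_left_eq_sub, Set.symmDiff_def,
    measureReal_union disjoint_sdiff_sdiff hts fst fts, mul_add]
  exact (norm_sub_le _ _).trans (add_le_add
    (norm_setIntegral_le_of_norm_le_const fst.lt_top fun g _ => hC g)
    (norm_setIntegral_le_of_norm_le_const fts.lt_top fun g _ => hC g))

theorem IsFolnerSequence.isAsymptoticallyInvariant {G : Type*} [CommGroup G] [TopologicalSpace G]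
    [IsTopologicalGroup G] [T2Space G] [SecondCountableTopology G]
    [MeasurableSpace G] [BorelSpace G] {μ : Measure G} [μ.IsHaarMeasure]
    {Λ : ℕ → Set G} (hΛ : IsFolnerSequence μ Λ) :
    IsAsymptoticallyInvariant fun n => ProbabilityTheory.cond μ (Λ n) := by
  intro u hu h
  obtain ⟨C, hC⟩ := hu.bdd
  have key := (ENNReal.tendsto_toReal ENNReal.zero_ne_top).comp
    (hΛ.isFoelner.tendsto_meas_smul_symmDiff h)
  refine squeeze_zero_norm (fun n => ?_) (by simpa using key.const_mul C)
  have hm : MeasurableSet (Λ n) := (hΛ.isCompact n).measurableSet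
  have hm' : MeasurableSet (h • Λ n) := hm.const_smul h
  have hf := hΛ.measure_ne_top n
  have htr : ∫ g in Λ n, u (g * h) ∂μ = ∫ g in h • Λ n, u g ∂μ := by
    have hmp := (measurePreserving_mul_right μ h).setIntegral_preimage_emb
      (measurableEmbedding_mulRight h) u (h • Λ n)
    rw [← hmp]
    congr 2
    ext x
    simp [Set.mem_smul_set_iff_inv_smul_mem, mul_comm x h]
  rw [integral_cond, integral_cond, ← mul_sub, htr, norm_mul, norm_inv,
    Real.norm_of_nonneg measureReal_nonneg]
  calc (μ.real (Λ n))⁻¹ * ‖(∫ g in h • Λ n, u g ∂μ) - ∫ g in Λ n, u g ∂μ‖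
      ≤ (μ.real (Λ n))⁻¹ * (C * μ.real (symmDiff (h • Λ n) (Λ n))) := by
        gcongr
        exact norm_setIntegral_sub_le_measureReal_symmDiff hm' hm (by simpa using hf) hf
          hu.continuous.aestronglyMeasurable hC
    _ = C * ((μ (symmDiff (h • Λ n) (Λ n))).toReal / (μ (Λ n)).toReal) := by
        simp only [Measure.real]; ring

/-! ### A correlation criterion in inner product spaces -/

/-- A Bessel-type inequality for vectors that need not be orthogonal. -/
theorem sq_sum_norm_inner_le {H ι : Type*} [SeminormedAddCommGroup H] [InnerProductSpace ℂ H]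
    (s : Finset ι) (x : H) (v : ι → H) :
    (∑ i ∈ s, ‖inner ℂ x (v i)‖) ^ 2 ≤ ‖x‖ ^ 2 * ∑ i ∈ s, ∑ j ∈ s, ‖inner ℂ (v i) (v j)‖ := by
  have hc : ∀ z : ℂ, ∃ c : ℂ, ‖c‖ ≤ 1 ∧ c * z = ‖z‖ := fun z => by
    rcases eq_or_ne z 0 with rfl | hz
    · exact ⟨0, by simp⟩
    · refine ⟨‖z‖ / z, by simp [hz], by field_simp⟩
  choose c hc1 hc2 using hc
  set d : ι → ℂ := fun i => c (inner ℂ x (v i))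
  have h1 : ((∑ i ∈ s, ‖inner ℂ x (v i)‖ : ℝ) : ℂ) = inner ℂ x (∑ i ∈ s, d i • v i) := by
    simp [inner_sum, inner_smul_right, d, hc2]
  have h2 : ∑ i ∈ s, ‖inner ℂ x (v i)‖ ≤ ‖x‖ * ‖∑ i ∈ s, d i • v i‖ := by
    have := norm_inner_le_norm (𝕜 := ℂ) x (∑ i ∈ s, d i • v i)
    rw [← h1, Complex.norm_real, Real.norm_of_nonneg (by positivity)] at this
    exact this
  have h3 : ‖∑ i ∈ s, d i • v i‖ ^ 2 ≤ ∑ i ∈ s, ∑ j ∈ s, ‖inner ℂ (v i) (v j)‖ := by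
    have h4 : ‖∑ i ∈ s, d i • v i‖ ^ 2
        = ‖inner ℂ (∑ i ∈ s, d i • v i) (∑ i ∈ s, d i • v i)‖ := by
      rw [inner_self_eq_norm_sq_to_K]; simp
    rw [h4, sum_inner]
    refine (norm_sum_le _ _).trans (Finset.sum_le_sum fun i _ => ?_)
    rw [inner_sum]
    refine (norm_sum_le _ _).trans (Finset.sum_le_sum fun j _ => ?_)
    rw [inner_smul_left, inner_smul_right, norm_mul, norm_mul, RCLike.norm_conj]
    calc _ ≤ 1 * (1 * ‖inner ℂ (v i) (v j)‖) := by
          gcongr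
          · exact hc1 _
          · exact hc1 _
      _ = _ := by ring
  calc _ ≤ (‖x‖ * ‖∑ i ∈ s, d i • v i‖) ^ 2 := by gcongr
    _ = ‖x‖ ^ 2 * ‖∑ i ∈ s, d i • v i‖ ^ 2 := by ring
    _ ≤ _ := by gcongr

/-- A variant of van der Corput's lemma with absolute values. If a given finite set of translates of
`f` can always be enlarged by a translate having small average correlation with each of them,
then `f` has long finite families of almost orthogonal translates. The Bessel-type inequality bounds
the mean of `|⟪x, f⟫|` over such a family, and asymptotic invariance turns this into a bound
for the averages of `|⟪x, f⟫|` itself. -/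
theorem isNull_inner_of_correlations {G : Type*} [CommGroup G] [TopologicalSpace G]
    [IsTopologicalGroup G] [MeasurableSpace G] [BorelSpace G]
    {ν : ℕ → Measure G} [∀ n, IsProbabilityMeasure (ν n)] (hν : IsAsymptoticallyInvariant ν)
    {H : Type*} [SeminormedAddCommGroup H] [InnerProductSpace ℂ H] (f : G → H) (x : H)
    (hf : ∃ C, ∀ g, ‖f g‖ ≤ C)
    (hx : IsBddCont fun g => inner ℂ x (f g))
    (hff : ∀ y z, IsBddCont fun g => inner ℂ (f (g * y)) (f (g * z)))
    (hcorr : ∀ ε > 0, ∀ s : Finset G, ∃ z, ∀ y ∈ s,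
      ∀ᶠ n in atTop, ∫ g, ‖inner ℂ (f (g * y)) (f (g * z))‖ ∂ν n < ε) :
    IsNull ν fun g => inner ℂ x (f g) := by
  obtain ⟨C, hC⟩ := hf
  have hC0 : 0 ≤ C := (norm_nonneg _).trans (hC 1)
  refine ⟨hx, ?_⟩
  rw [Metric.tendsto_nhds]
  intro δ hδ
  -- `η` is chosen so that the final bound `δ / 4 + ‖x‖² η / (δ / 4) + δ / 4` is less than `δ`
  obtain ⟨η, hη, hηδ⟩ : ∃ η > 0, (‖x‖ ^ 2 * η) / (δ / 4) ≤ δ / 4 := by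
    refine ⟨(δ / 4) ^ 2 / (‖x‖ ^ 2 + 1), by positivity, ?_⟩
    rw [div_le_iff₀ (by positivity), ← mul_div_assoc, div_le_iff₀ (by positivity)]
    nlinarith [sq_nonneg (δ / 4)]
  obtain ⟨p, -, hp⟩ := exists_seq_of_forall_finset_exists (fun _ : G => True)
    (fun y z => ∀ᶠ n in atTop, ∫ g, ‖inner ℂ (f (g * y)) (f (g * z))‖ ∂ν n < η / 2)
    (fun s _ => by
      obtain ⟨z, hz⟩ := hcorr (η / 2) (by positivity) s
      exact ⟨z, trivial, hz⟩)
  obtain ⟨N, hN⟩ := exists_nat_gt (C ^ 2 / (η / 2))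
  have hN0 : (0 : ℝ) < N := lt_of_le_of_lt (by positivity) hN
  have hCN : C ^ 2 ≤ N * (η / 2) := ((div_lt_iff₀ (by positivity)).1 hN).le
  have hoff : ∀ i j, i ≠ j → ∀ᶠ n in atTop,
      ∫ g, ‖inner ℂ (f (g * p i)) (f (g * p j))‖ ∂ν n < η / 2 := by
    intro i j hij
    rcases lt_or_gt_of_ne hij with h | h
    · exact hp i j h
    · simpa only [norm_inner_symm] using hp j i h
  have hall : ∀ᶠ n in atTop, ∀ i ∈ Finset.range N, ∀ j ∈ Finset.range N, i ≠ j →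
      ∫ g, ‖inner ℂ (f (g * p i)) (f (g * p j))‖ ∂ν n < η / 2 := by
    simp only [Filter.eventually_all_finset]
    intro i _ j _
    by_cases hij : i = j
    · simp [hij]
    · simpa [hij] using hoff i j hij
  have hinv : ∀ᶠ n in atTop, ∀ i ∈ Finset.range N,
      ∫ g, ‖inner ℂ x (f g)‖ ∂ν n - δ / 4 ≤ ∫ g, ‖inner ℂ x (f (g * p i))‖ ∂ν n := by
    rw [Filter.eventually_all_finset]
    intro i _
    filter_upwards [(hν _ hx.norm (p i)).eventually_const_lt
      (show -(δ / 4) < 0 by linarith)] with n hn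
    linarith
  filter_upwards [hall, hinv] with n hn1 hn2
  rw [dist_zero_right, Real.norm_of_nonneg (integral_nonneg fun g => norm_nonneg _)]
  -- the correlation sum
  have hD : ∫ g, (∑ i ∈ Finset.range N, ∑ j ∈ Finset.range N,
      ‖inner ℂ (f (g * p i)) (f (g * p j))‖) ∂ν n ≤ N ^ 2 * η := by
    rw [integral_finsetSum _ fun i _ =>
      (IsBddCont.sum _ fun j _ => (hff (p i) (p j)).norm).integrable]
    have hrow : ∀ i ∈ Finset.range N, ∫ g, (∑ j ∈ Finset.range N,
        ‖inner ℂ (f (g * p i)) (f (g * p j))‖) ∂ν n ≤ N * η := by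
      intro i hi
      rw [integral_finsetSum _ fun j _ => (hff (p i) (p j)).norm.integrable]
      calc _ ≤ ∑ j ∈ Finset.range N, ((if i = j then C ^ 2 else 0) + η / 2) := by
            refine Finset.sum_le_sum fun j hj => ?_
            by_cases hij : i = j
            · subst hij
              have hle : ∫ g, ‖inner ℂ (f (g * p i)) (f (g * p i))‖ ∂ν n ≤ ∫ g, C ^ 2 ∂ν n := by
                refine integral_mono (hff (p i) (p i)).norm.integrable (integrable_const _)
                  fun g => (norm_inner_le_norm _ _).trans ?_
                rw [sq]
                exact mul_le_mul (hC _) (hC _) (norm_nonneg _) hC0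
              simp only [integral_const, probReal_univ, one_smul] at hle
              simp only [if_true]
              linarith
            · simpa [hij] using (hn1 i hi j hj hij).le
        _ = C ^ 2 + N * (η / 2) := by
            rw [Finset.sum_add_distrib, Finset.sum_ite_eq, if_pos hi]; simp
        _ ≤ N * η := by linarith
    calc _ ≤ ∑ i ∈ Finset.range N, (N * η : ℝ) := Finset.sum_le_sum hrow
      _ = N ^ 2 * η := by simp; ring
  -- `w ≤ δ / 4 + w² / (δ / 4)` combined with the Bessel-type inequality
  have hw : ∫ g, (∑ i ∈ Finset.range N, ‖inner ℂ x (f (g * p i))‖) ∂ν n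
      ≤ N * (δ / 4 + δ / 4) := by
    have hi : ∀ i ∈ Finset.range N, IsBddCont fun g => ‖inner ℂ x (f (g * p i))‖ :=
      fun i _ => (hx.comp_mul_right (p i)).norm
    have hDi : Integrable (fun g => ∑ i ∈ Finset.range N, ∑ j ∈ Finset.range N,
        ‖inner ℂ (f (g * p i)) (f (g * p j))‖) (ν n) :=
      (IsBddCont.sum _ fun i _ => .sum _ fun j _ => (hff (p i) (p j)).norm).integrable
    calc _ ≤ ∫ g, (N * (δ / 4) + (‖x‖ ^ 2 / (N * (δ / 4))) * ∑ i ∈ Finset.range N,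
            ∑ j ∈ Finset.range N, ‖inner ℂ (f (g * p i)) (f (g * p j))‖) ∂ν n := by
          refine integral_mono (IsBddCont.sum _ hi).integrable
            ((integrable_const _).add (hDi.const_mul _)) fun g => ?_
          have hb := sq_sum_norm_inner_le (Finset.range N) x fun i => f (g * p i)
          simp only
          rw [div_mul_eq_mul_div, ← sub_le_iff_le_add', le_div_iff₀ (by positivity)]
          refine le_trans ?_ hb
          set w := ∑ i ∈ Finset.range N, ‖inner ℂ x (f (g * p i))‖
          nlinarith [sq_nonneg (w - N * (δ / 4)), show 0 ≤ w * (N * (δ / 4)) by positivity]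
      _ = N * (δ / 4) + (‖x‖ ^ 2 / (N * (δ / 4))) * ∫ g, (∑ i ∈ Finset.range N,
            ∑ j ∈ Finset.range N, ‖inner ℂ (f (g * p i)) (f (g * p j))‖) ∂ν n := by
          rw [integral_add (integrable_const _) (hDi.const_mul _), integral_const, probReal_univ,
            one_smul, integral_const_mul]
      _ ≤ N * (δ / 4) + (‖x‖ ^ 2 / (N * (δ / 4))) * (N ^ 2 * η) := by gcongr
      _ = N * (δ / 4 + (‖x‖ ^ 2 * η) / (δ / 4)) := by field_simp
      _ ≤ _ := by gcongr
  rw [integral_finsetSum _ fun i _ => (hx.comp_mul_right (p i)).norm.integrable] at hw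
  have hsum := Finset.sum_le_sum hn2
  rw [Finset.sum_const, Finset.card_range, nsmul_eq_mul] at hsum
  have := le_of_mul_le_mul_left (hsum.trans hw) hN0
  linarith

namespace CStarDynamicalSystem

/-! ### The state as a bounded positive functional -/

section State

variable {G A : Type*} [Group G] [MeasurableSpace G] [CStarAlgebra A]
  (S : CStarDynamicalSystem G A)

theorem ω_nonneg [PartialOrder A] [StarOrderedRing A] {a : A} (ha : 0 ≤ a) : 0 ≤ S.ω a := by
  obtain ⟨b, rfl⟩ := CStarAlgebra.nonneg_iff_eq_star_mul_self.1 ha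
  exact S.map_star_mul_self_nonneg b

theorem exists_clm : ∃ T : A →L[ℂ] ℂ, ∀ a, T a = S.ω a := by
  let _ := CStarAlgebra.spectralOrder A
  let _ := CStarAlgebra.spectralOrderedRing A
  obtain ⟨C, hC⟩ := (PositiveLinearMap.mk₀ S.ω fun _ => S.ω_nonneg).exists_norm_apply_le
  exact ⟨S.ω.mkContinuous C hC, fun _ => rfl⟩

theorem ω_star (a : A) : S.ω (star a) = star (S.ω a) := by
  let _ := CStarAlgebra.spectralOrder A
  let _ := CStarAlgebra.spectralOrderedRing A
  exact map_star (PositiveLinearMap.mk₀ S.ω fun _ => S.ω_nonneg) a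

theorem isBddCont_ω {u : G → A} [TopologicalSpace G] (hu : IsBddCont u) :
    IsBddCont fun g => S.ω (u g) := by
  obtain ⟨T, hT⟩ := S.exists_clm
  simpa only [hT] using hu.clm_apply T

theorem isNull_ω [TopologicalSpace G] [OpensMeasurableSpace G] {ν : ℕ → Measure G}
    [∀ n, IsProbabilityMeasure (ν n)] {u : G → A} (hu : IsNull ν u) :
    IsNull ν fun g => S.ω (u g) := by
  obtain ⟨T, hT⟩ := S.exists_clm
  simpa only [hT] using hu.clm_apply T

/-- The correlation criterion in the GNS space of the state. -/
theorem isNull_ω_mul_of_correlations {G : Type*} [CommGroup G] [TopologicalSpace G]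
    [IsTopologicalGroup G] [MeasurableSpace G] [BorelSpace G]
    (S : CStarDynamicalSystem G A) {ν : ℕ → Measure G} [∀ n, IsProbabilityMeasure (ν n)]
    (hν : IsAsymptoticallyInvariant ν) {f : G → A} (hf : IsBddCont f) (x : A)
    (hcorr : ∀ ε > 0, ∀ s : Finset G, ∃ z, ∀ y ∈ s,
      ∀ᶠ n in atTop, ∫ g, ‖S.ω (star (f (g * y)) * f (g * z))‖ ∂ν n < ε) :
    IsNull ν fun g => S.ω (x * f g) := by
  let _ := CStarAlgebra.spectralOrder A
  let _ := CStarAlgebra.spectralOrderedRing A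
  set F := PositiveLinearMap.mk₀ S.ω fun _ => S.ω_nonneg
  have key := isNull_inner_of_correlations hν (fun g => F.toPreGNS (f g)) (F.toPreGNS (star x))
    ?_ ?_ ?_ ?_
  · have h : (fun g => S.ω (x * f g))
        = fun g => inner ℂ (F.toPreGNS (star x)) (F.toPreGNS (f g)) := by
      funext g
      rw [PositiveLinearMap.preGNS_inner_def]
      simp only [PositiveLinearMap.ofPreGNS_toPreGNS, star_star]
      rfl
    rw [h]
    exact key
  · obtain ⟨C, hC⟩ := (S.isBddCont_ω (hf.star.mul hf)).bdd
    refine ⟨√C, fun g => Real.le_sqrt_of_sq_le ?_⟩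
    have h := congrArg norm (F.preGNS_norm_sq (F.toPreGNS (f g)))
    rw [norm_pow, Complex.norm_real, norm_norm] at h
    rw [h]
    exact hC g
  · have h := S.isBddCont_ω ((IsBddCont.const (star (star x))).mul hf)
    exact h
  · intro y z
    exact S.isBddCont_ω ((hf.comp_mul_right y).star.mul (hf.comp_mul_right z))
  · exact hcorr

theorem norm_τ (g : G) (a : A) : ‖S.τ g a‖ = ‖a‖ := StarAlgEquiv.norm_map (S.τ g) a

end State

/-! ### Products along several homomorphisms -/

section Products

variable {G A : Type*} [CommGroup G] [MeasurableSpace G] [CStarAlgebra A]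
  (S : CStarDynamicalSystem G A)

/-- The ordered product `τ_{φ₁(g)}(a₁) ⋯ τ_{φₖ(g)}(aₖ)` for a list of pairs `(φⱼ, aⱼ)`. -/
noncomputable def orbitProd (L : List ((G →* G) × A)) (g : G) : A :=
  (L.map fun p => S.τ (p.1 g) p.2).prod

/-- The product `ω(a₁) ⋯ ω(aₖ)` for a list of pairs `(φⱼ, aⱼ)`. -/
noncomputable def stateProd (L : List ((G →* G) × A)) : ℂ := (L.map fun p => S.ω p.2).prod

/-- The list of pairs `(φⱼ, aⱼ* τ_{φⱼ(h)}(aⱼ))`, which describes the correlations of the product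
over the list of pairs `(φⱼ, aⱼ)` with its translate by `h`. -/
noncomputable def corrList (L : List ((G →* G) × A)) (h : G) : List ((G →* G) × A) :=
  L.map fun p => (p.1, star p.2 * S.τ (p.1 h) p.2)

theorem orbitProd_cons (p : (G →* G) × A) (L : List ((G →* G) × A)) (g : G) :
    S.orbitProd (p :: L) g = S.τ (p.1 g) p.2 * S.orbitProd L g := by simp [orbitProd]

theorem stateProd_cons (p : (G →* G) × A) (L : List ((G →* G) × A)) :
    S.stateProd (p :: L) = S.ω p.2 * S.stateProd L := by simp [stateProd]

theorem corrList_cons (p : (G →* G) × A) (L : List ((G →* G) × A)) (h : G) :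
    S.corrList (p :: L) h = (p.1, star p.2 * S.τ (p.1 h) p.2) :: S.corrList L h := by
  simp [corrList]

theorem τ_τ (g h : G) (a : A) : S.τ g (S.τ h a) = S.τ (g * h) a := by rw [map_mul]; rfl

theorem τ_τ_inv_mul (φ ψ : G →* G) (g : G) (a : A) :
    S.τ (φ g) (S.τ ((φ⁻¹ * ψ) g) a) = S.τ (ψ g) a := by
  rw [τ_τ, MonoidHom.mul_apply, MonoidHom.inv_apply, mul_inv_cancel_left]

/-- Invariance of the state removes the homomorphism of the first factor. -/
theorem ω_orbitProd_cons (p : (G →* G) × A) (L : List ((G →* G) × A)) (g : G) :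
    S.ω (S.orbitProd (p :: L) g)
      = S.ω (p.2 * S.orbitProd (L.map fun q => (p.1⁻¹ * q.1, q.2)) g) := by
  rw [← S.invariant (p.1 g) (p.2 * _), orbitProd_cons, map_mul (S.τ (p.1 g))]
  congr 2
  simp only [orbitProd, map_list_prod, List.map_map]
  congr 1
  exact List.map_congr_left fun q _ => (S.τ_τ_inv_mul p.1 q.1 g q.2).symm

variable [TopologicalSpace G] {M : Set (G →* G)} {ν : ℕ → Measure G} {S}

theorem isBddCont_orbitProd (hc : ∀ φ ∈ M, ∀ b, Continuous fun g => S.τ (φ g) b)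
    {L : List ((G →* G) × A)} (hL : ∀ p ∈ L, p.1 ∈ M) : IsBddCont (S.orbitProd L) := by
  induction L with
  | nil => exact .const 1
  | cons p L ih =>
    have h : S.orbitProd (p :: L) = fun g => S.τ (p.1 g) p.2 * S.orbitProd L g :=
      funext fun g => S.orbitProd_cons p L g
    rw [h]
    exact IsBddCont.mul ⟨hc _ (hL p (by simp)) _, ‖p.2‖, fun g => (S.norm_τ _ _).le⟩
      (ih fun q hq => hL q (by simp [hq]))

variable [OpensMeasurableSpace G] [∀ n, IsProbabilityMeasure (ν n)]

theorem isNull_commutator (hM : IsTranslational M)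
    (hc : ∀ φ ∈ M, ∀ b, Continuous fun g => S.τ (φ g) b)
    (hab : ∀ φ ∈ M, ∀ a b, IsNull ν fun g => a * S.τ (φ g) b - S.τ (φ g) b * a)
    {φ ψ : G →* G} (hφ : φ ∈ M) (hψ : ψ ∈ M) (hne : φ ≠ ψ) (a b : A) :
    IsNull ν fun g => S.τ (φ g) a * S.τ (ψ g) b - S.τ (ψ g) b * S.τ (φ g) a := by
  have hφa : IsBddCont fun g => S.τ (φ g) a := ⟨hc φ hφ a, ‖a‖, fun g => (S.norm_τ _ _).le⟩
  have hψb : IsBddCont fun g => S.τ (ψ g) b := ⟨hc ψ hψ b, ‖b‖, fun g => (S.norm_τ _ _).le⟩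
  refine (hab _ (hM ψ hψ φ hφ hne.symm) a b).of_norm_le_mul
    ((hφa.mul hψb).sub (hψb.mul hφa)) 1 fun g => ?_
  rw [one_mul, ← S.norm_τ (φ g) (a * _ - _), map_sub, map_mul, map_mul, τ_τ_inv_mul]

theorem isNull_commutator_orbitProd (hM : IsTranslational M)
    (hc : ∀ φ ∈ M, ∀ b, Continuous fun g => S.τ (φ g) b)
    (hab : ∀ φ ∈ M, ∀ a b, IsNull ν fun g => a * S.τ (φ g) b - S.τ (φ g) b * a)
    {L : List ((G →* G) × A)} (hL : ∀ p ∈ L, p.1 ∈ M) {φ : G →* G} (hφ : φ ∈ M)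
    (hne : ∀ p ∈ L, p.1 ≠ φ) (b : A) :
    IsNull ν fun g => S.orbitProd L g * S.τ (φ g) b - S.τ (φ g) b * S.orbitProd L g := by
  induction L with
  | nil => simpa [orbitProd] using IsNull.zero
  | cons p L ih =>
    have hL' : ∀ q ∈ L, q.1 ∈ M := fun q hq => hL q (by simp [hq])
    have h1 := IsNull.mul_left (v := fun g => S.τ (p.1 g) p.2)
      ⟨hc _ (hL p (by simp)) _, ‖p.2‖, fun g => (S.norm_τ _ _).le⟩
      (ih hL' fun q hq => hne q (by simp [hq]))
    have h2 := (isNull_commutator hM hc hab (hL p (by simp)) hφ (hne p (by simp)) p.2 b).mul_right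
      (isBddCont_orbitProd hc hL')
    convert h1.add h2 using 2 with g
    rw [orbitProd_cons]
    noncomm_ring

/-- By asymptotic abelianness, the correlation of a product with its translate by `h` is in mean
the product of the correlations of its factors. -/
theorem isNull_star_orbitProd_mul [IsTopologicalGroup G] (hM : IsTranslational M)
    (hc : ∀ φ ∈ M, ∀ b, Continuous fun g => S.τ (φ g) b)
    (hab : ∀ φ ∈ M, ∀ a b, IsNull ν fun g => a * S.τ (φ g) b - S.τ (φ g) b * a)
    {L : List ((G →* G) × A)} (hL : ∀ p ∈ L, p.1 ∈ M) (hd : (L.map Prod.fst).Nodup) (h : G) :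
    IsNull ν fun g =>
      star (S.orbitProd L g) * S.orbitProd L (g * h) - S.orbitProd (S.corrList L h) g := by
  induction L with
  | nil => simpa [orbitProd, corrList] using IsNull.zero
  | cons p L ih =>
    have hL' : ∀ q ∈ L, q.1 ∈ M := fun q hq => hL q (by simp [hq])
    rw [List.map_cons, List.nodup_cons] at hd
    set b := star p.2 * S.τ (p.1 h) p.2 with hb
    have hX : IsBddCont fun g => S.τ (p.1 g) b :=
      ⟨hc _ (hL p (by simp)) _, ‖b‖, fun g => (S.norm_τ _ _).le⟩
    have h1 := IsNull.mul_left hX (ih hL' hd.2)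
    have h2 := (isNull_commutator_orbitProd hM hc hab hL' (hL p (by simp))
      (fun q hq heq => hd.1 (heq ▸ List.mem_map_of_mem hq)) (star b)).star.mul_right
      ((isBddCont_orbitProd hc hL').comp_mul_right h)
    convert h1.sub h2 using 2 with g
    have hX2 : S.τ (p.1 g) b = star (S.τ (p.1 g) p.2) * S.τ (p.1 (g * h)) p.2 := by
      rw [hb, map_mul, map_star, τ_τ, map_mul p.1]
    simp only [corrList_cons, orbitProd_cons, star_sub, star_mul, ← map_star, star_star, ← hb]
    rw [map_star, mul_assoc, ← mul_assoc (star (S.τ (p.1 g) p.2)), ← hX2]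
    noncomm_ring

end Products

/-! ### The induction on the number of homomorphisms -/

section Induction

variable {G A : Type*} [CommGroup G] [TopologicalSpace G] [MeasurableSpace G] [BorelSpace G]
  [CStarAlgebra A] {S : CStarDynamicalSystem G A} {M : Set (G →* G)} {ν ν' : ℕ → Measure G}
  [∀ n, IsProbabilityMeasure (ν' n)]

/-- By weak mixing, the limiting correlation of a product with its translate by `h` tends in mean
to the square of the modulus of the expected limit. -/
theorem isNull_stateProd_corrList
    (hmix : ∀ φ ∈ M, ∀ a b, IsNull ν' fun g => S.ω (a * S.τ (φ g) b) - S.ω a * S.ω b)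
    {L : List ((G →* G) × A)} (hL : ∀ p ∈ L, p.1 ∈ M) :
    IsNull ν' fun h => S.stateProd (S.corrList L h) - star (S.stateProd L) * S.stateProd L := by
  induction L with
  | nil => simpa [stateProd, corrList] using IsNull.zero
  | cons p L ih =>
    have ih' := ih fun q hq => hL q (by simp [hq])
    have hp := hL p (by simp)
    have h1 := hmix p.1 hp (star p.2) p.2
    -- boundedness of the first term follows from that of the difference
    have hb : IsBddCont fun h => S.stateProd (S.corrList L h) := by
      simpa using ih'.isBddCont.add (.const (star (S.stateProd L) * S.stateProd L))
    convert (h1.mul_right hb).add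
      (ih'.mul_left (.const (S.ω (star p.2) * S.ω p.2))) using 2 with h
    rw [corrList_cons, stateProd_cons, stateProd_cons, star_mul', ω_star]
    ring

/-- The induction on the number `k` of homomorphisms. The case of `k` homomorphisms yields the
correlations of the centred products of `k + 1` factors, and the correlation criterion then gives
the case of `k + 1`. Weak mixing may be tested along a second sequence `ν'`, since it serves only
to find single translates with small correlations. -/
theorem isNull_ω_mul_orbitProd [IsTopologicalGroup G] [∀ n, IsProbabilityMeasure (ν n)]
    (hν : IsAsymptoticallyInvariant ν)
    (hν' : IsAsymptoticallyInvariant ν') (hM : IsTranslational M)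
    (hc : ∀ φ ∈ M, ∀ b, Continuous fun g => S.τ (φ g) b)
    (hab : ∀ φ ∈ M, ∀ a b, IsNull ν fun g => a * S.τ (φ g) b - S.τ (φ g) b * a)
    (hmix : ∀ φ ∈ M, ∀ a b, IsNull ν' fun g => S.ω (a * S.τ (φ g) b) - S.ω a * S.ω b)
    (k : ℕ) (L : List ((G →* G) × A)) (hk : L.length = k) (hL : ∀ p ∈ L, p.1 ∈ M)
    (hd : (L.map Prod.fst).Nodup) (a : A) :
    IsNull ν fun g => S.ω (a * S.orbitProd L g) - S.ω a * S.stateProd L := by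
  induction k generalizing L a with
  | zero =>
    obtain rfl := List.length_eq_zero_iff.1 hk
    simpa [orbitProd, stateProd] using IsNull.zero
  | succ k ih =>
    -- the case without the factor `a` follows from the induction hypothesis by invariance
    have hplain : ∀ L : List ((G →* G) × A), L.length = k + 1 → (∀ p ∈ L, p.1 ∈ M) →
        (L.map Prod.fst).Nodup → IsNull ν fun g => S.ω (S.orbitProd L g) - S.stateProd L := by
      intro L hk hL hd
      obtain ⟨p, L, rfl⟩ := List.exists_cons_of_length_eq_add_one hk
      rw [List.map_cons, List.nodup_cons] at hd
      have h := ih (L.map fun q => (p.1⁻¹ * q.1, q.2)) (by simpa using hk)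
        (by
          intro q hq
          obtain ⟨r, hr, rfl⟩ := List.mem_map.1 hq
          exact hM _ (hL r (by simp [hr])) _ (hL p (by simp))
            fun heq => hd.1 (heq ▸ List.mem_map_of_mem hr))
        (by
          have := hd.2.map (mul_right_injective p.1⁻¹)
          simpa [List.map_map, Function.comp_def] using this) p.2
      convert h using 2 with g
      rw [ω_orbitProd_cons, stateProd_cons]
      simp [stateProd, Function.comp_def]
    set c := S.stateProd L with hcdef
    have hP : IsBddCont (S.orbitProd L) := isBddCont_orbitProd hc hL
    have hf : IsBddCont fun g => S.orbitProd L g - algebraMap ℂ A c := hP.sub (.const _)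
    -- correlations of the centred products
    have hcor : ∀ h, IsNull ν fun g =>
        S.ω (star (S.orbitProd L g - algebraMap ℂ A c) *
          (S.orbitProd L (g * h) - algebraMap ℂ A c))
          - (S.stateProd (S.corrList L h) - star c * c) := by
      intro h
      have h1 := S.isNull_ω (isNull_star_orbitProd_mul hM hc hab hL hd h)
      have h2 := hplain (S.corrList L h) (by simpa [corrList] using hk)
        (by
          intro q hq
          obtain ⟨r, hr, rfl⟩ := List.mem_map.1 hq
          exact hL r hr)
        (by simpa [corrList, List.map_map, Function.comp_def] using hd)
      have h3 := hplain L hk hL hd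
      have h4 := h3.star.mul_left (.const c)
      have h5 := (h3.comp_mul_right hν h).mul_left (.const (star c))
      convert ((h1.add h2).sub h4).sub h5 using 2 with g
      have hexp : star (S.orbitProd L g - algebraMap ℂ A c) *
          (S.orbitProd L (g * h) - algebraMap ℂ A c)
          = star (S.orbitProd L g) * S.orbitProd L (g * h) - c • star (S.orbitProd L g)
            - star c • S.orbitProd L (g * h) + (star c * c) • (1 : A) := by
        rw [Algebra.algebraMap_eq_smul_one]
        simp only [star_sub, star_smul, star_one, sub_mul, mul_sub, smul_mul_assoc, mul_smul_comm,
          one_mul, mul_one, smul_sub, smul_smul, mul_comm c]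
        abel
      rw [hexp]
      simp only [map_add, map_sub, map_smul, S.map_one, ω_star, smul_eq_mul, star_sub, ← hcdef]
      ring
    have key := S.isNull_ω_mul_of_correlations hν hf a ?_
    · convert key using 2 with g
      simp [mul_sub, Algebra.algebraMap_eq_smul_one, mul_comm]
    · intro ε hε s
      have hγ := isNull_stateProd_corrList hmix hL
      -- one point at which all the limiting correlations with the given translates are small
      obtain ⟨z, hz⟩ := (IsNull.sum s fun y _ =>
        (hγ.comp_mul_right hν' y⁻¹).norm).exists_norm_lt hε
      refine ⟨z, fun y hy => ?_⟩
      have hyz : ‖S.stateProd (S.corrList L (z * y⁻¹)) - star c * c‖ < ε := by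
        refine lt_of_le_of_lt ?_ hz
        rw [Real.norm_of_nonneg (Finset.sum_nonneg fun _ _ => norm_nonneg _)]
        exact Finset.single_le_sum (f := fun y => ‖S.stateProd (S.corrList L (z * y⁻¹))
          - star (S.stateProd L) * S.stateProd L‖) (fun _ _ => norm_nonneg _) hy
      have hN := (hcor (z * y⁻¹)).comp_mul_right hν y
      filter_upwards [hN.tendsto.eventually_lt_const (sub_pos.2 hyz)] with n hn
      have hB : IsBddCont fun g => S.ω (star (S.orbitProd L (g * y) - algebraMap ℂ A c) *
          (S.orbitProd L (g * z) - algebraMap ℂ A c)) :=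
        S.isBddCont_ω ((hf.comp_mul_right y).star.mul (hf.comp_mul_right z))
      have hgz : ∀ g : G, g * y * (z * y⁻¹) = g * z := fun g => by
        rw [mul_comm z, mul_assoc, mul_inv_cancel_left]
      simp only [hgz] at hn hN
      have hle := integral_mono (μ := ν n) hB.norm.integrable
        (hN.isBddCont.norm.integrable.add (integrable_const
          ‖S.stateProd (S.corrList L (z * y⁻¹)) - star c * c‖))
        fun g => norm_le_norm_sub_add _ _
      simp only [Pi.add_apply] at hle
      rw [integral_add hN.isBddCont.norm.integrable (integrable_const _), integral_const,
        probReal_univ, one_smul] at hle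
      linarith

end Induction

end CStarDynamicalSystem

theorem theorem4p6 {G : Type*} [CommGroup G] [TopologicalSpace G] [IsTopologicalGroup G]
    [T2Space G] [LocallyCompactSpace G] [SecondCountableTopology G]
    [MeasurableSpace G] [BorelSpace G] (μ : Measure G) [μ.IsHaarMeasure]
    (Λ : ℕ → Set G) (hΛ : IsFolnerSequence μ Λ) (hT : TempelmanCondition μ Λ)
    (hΛ' : IsFolnerSequence μ fun n => (Λ n)⁻¹ * Λ n)
    (M : Set (G →* G)) (hM : IsTranslational M)
    {A : Type*} [CStarAlgebra A] (S : CStarDynamicalSystem G A)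
    -- weak mixing relative to some Følner sequence, which may be `Λ` itself
    (Γ : ℕ → Set G) (hΓ : IsFolnerSequence μ Γ) (hmix : S.IsWeaklyMixing μ M Γ)
    (hab : S.IsAsymptoticallyAbelian μ M Λ)
    (k : ℕ) (φ : Fin k → (G →* G)) (hφM : ∀ j, φ j ∈ M) (hφ : Function.Injective φ)
    (a : Fin (k + 1) → A) :
    -- `Fin.cons 1 φ` is the list `φ₀, φ₁, …, φₖ` with `φ₀` the trivial homomorphism
    Tendsto
      (fun n => (μ.real (Λ n))⁻¹ * ∫ g in Λ n,
        ‖S.ω (List.ofFn fun j : Fin (k + 1) =>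
              S.τ ((Fin.cons 1 φ : Fin (k + 1) → (G →* G)) j g) (a j)).prod
          - ∏ j, S.ω (a j)‖ ∂μ)
      atTop (𝓝 0) := by
  have := hΛ.isProbabilityMeasure_cond
  have := hΓ.isProbabilityMeasure_cond
  have hbc : ∀ ψ ∈ M, ∀ b, IsBddCont fun g => S.τ (ψ g) b := fun ψ hψ b =>
    ⟨hab.continuous ψ hψ b, ‖b‖, fun g => (S.norm_τ _ _).le⟩
  have key := CStarDynamicalSystem.isNull_ω_mul_orbitProd (S := S)
    hΛ.isAsymptoticallyInvariant hΓ.isAsymptoticallyInvariant hM hab.continuous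
    (fun ψ hψ b d => ⟨((IsBddCont.const b).mul (hbc ψ hψ d)).sub
      ((hbc ψ hψ d).mul (.const b)), by simpa only [integral_cond] using hab.tendsto ψ hψ b d⟩)
    (fun ψ hψ b d => ⟨(S.isBddCont_ω ((IsBddCont.const b).mul (hbc ψ hψ d))).sub (.const _),
      by simpa only [integral_cond] using hmix.tendsto ψ hψ b d⟩)
    k (List.ofFn fun j => (φ j, a j.succ)) (by simp)
    (by simpa [List.mem_ofFn] using hφM)
    (by simpa [List.map_ofFn, Function.comp_def, List.nodup_ofFn] using hφ) (a 0)
  have h := key.tendsto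
  simp only [integral_cond] at h
  simpa [CStarDynamicalSystem.orbitProd, CStarDynamicalSystem.stateProd, List.ofFn_succ,
    Fin.prod_univ_succ, List.map_ofFn, Function.comp_def, List.prod_ofFn] using h
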